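/- Let $m\ge 1$. Consider $m+1$ parties: Alice, who holds $\mathbb C^{m+2}$ with orthonormal basis $|p\rangle,|q\rangle,|1\rangle,\dots,|m\rangle$, and Bob-$1,\dots,$ Bob-$m$, where Bob-$j$ holds $\mathbb C^{3}$ with orthonormal basis $|p\rangle,|q\rangle,|j\rangle$. Put $|\epsilon_\pm\rangle=\frac1{\sqrt2}(|p\rangle\pm|q\rangle)$ and $|\gamma^i_\pm\rangle=\frac1{\sqrt2}(|q\rangle\pm|i\rangle)$, and let $\mathbb G_{m+1}\subset\mathbb C^{m+2}\otimes(\mathbb C^3)^{\otimes m}$ consist of the $6m+2$ states $$|\zeta^0_\pm\rangle=|\epsilon_\pm\rangle_A\bigotimes_{j=1}^m|j\rangle_{B_j},\qquad |\zeta^{i,1}_\pm\rangle=|i\rangle_A\,|\gamma^i_\pm\rangle_{B_i}\bigotimes_{j\ne i}|j\rangle_{B_j},$$ $$|\zeta^{i,2}_\pm\rangle=|\gamma^i_\pm\rangle_A\,|p\rangle_{B_i}\bigotimes_{j\ne i}|j\rangle_{B_j},\qquad |\zeta^{i,3}_\pm\rangle=|p\rangle_A\,|\epsilon_\pm\rangle_{B_i}\bigotimes_{j\ne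 i}|j\rangle_{B_j}\qquad(1\le i\le m).$$ Then $\mathbb G_{m+1}$ is a genuinely nonlocal set of product states (GNPS): its members are orthonormal fully product states, and whenever the $m+1$ parties are divided into groups, not all of them in one group, with the members of each group coming together, no protocol of local operations (each group acting on its joint system) and classical communication between the groups, with finitely many or unboundedly many rounds, identifies every state of $\mathbb G_{m+1}$ with probability one. In particular, perfect LOCC discrimination of $\mathbb G_{m+1}$ is impossible even if any $m$ of the $m+1$ parties come together. -/

import Mathlib

open scoped Matrix

noncomputable section

/-!
Composite systems: the Hilbert space of parties `c : κ` with local orthonormal bases indexed by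
`X c` is `EuclideanSpace ℂ (∀ c, X c)`, i.e. the tensor product `⨂ c, ℂ^(X c)` in coordinates.
-/

/-- The tensor product operator `⨂ c, A c` applied to a (not necessarily normalized) vector. -/
def applyLocal {κ : Type} [Fintype κ] [DecidableEq κ] {X Y : κ → Type} [∀ c, Fintype (X c)]
    (A : ∀ c, Matrix (Y c) (X c) ℂ) (v : (∀ c, X c) → ℂ) : (∀ c, Y c) → ℂ :=
  fun y => ∑ x, (∏ c, A c (y c) (x c)) * v x

/-- The fully product vector `⨂ j, φ j`. -/
def productState {ι : Type} [Fintype ι] {X : ι → Type}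
    (φ : ∀ j, EuclideanSpace ℂ (X j)) : EuclideanSpace ℂ (∀ j, X j) :=
  WithLp.toLp 2 fun x => ∏ j, φ j (x j)

/-- An LOCC protocol of the parties `κ`, with local systems `ℂ^(X c)`, whose task is to announce
an element of `G`. The number of rounds need not be bounded.

A node is the classical information (the transcript) that is known to all the parties. At first
every party may enlarge its system by an isometry, such as adding a local ancilla. At a node
without verdict one party, the actor, performs a measurement on its own system with finitely many
outcomes, given by Kraus operators, and broadcasts the outcome; every other party may then apply to
its own system an isometry that depends on the outcome. At a node with a verdict the protocol
stops and the verdict is announced (what the other fields say at such a node is irrelevant).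
All local dimensions may change from node to node. -/
structure LOCCProtocol (κ : Type) (X : κ → Type) [∀ c, Fintype (X c)] [∀ c, DecidableEq (X c)]
    (G : Type) where
  Node : Type
  root : Node
  dim : Node → κ → ℕ
  init : ∀ c, Matrix (Fin (dim root c)) (X c) ℂ
  init_isometry : ∀ c, (init c)ᴴ * init c = 1
  verdict : Node → Option G
  actor : Node → κ
  outcomes : Node → ℕ
  next : ∀ s, Fin (outcomes s) → Node
  kraus : ∀ s (k : Fin (outcomes s)) (c : κ), Matrix (Fin (dim (next s k) c)) (Fin (dim s c)) ℂ
  kraus_complete : ∀ s, ∑ k, (kraus s k (actor s))ᴴ * kraus s k (actor s) = 1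
  kraus_isometry : ∀ s k c, c ≠ actor s → (kraus s k c)ᴴ * kraus s k c = 1

/-- The probability that, from node `s` with the unnormalized state vector `v`, the protocol
stops within `n` further rounds and announces `g`. -/
def LOCCProtocol.prob {κ : Type} [Fintype κ] [DecidableEq κ] {X : κ → Type}
    [∀ c, Fintype (X c)] [∀ c, DecidableEq (X c)] {G : Type} [DecidableEq G]
    (P : LOCCProtocol κ X G) (g : G) :
    ℕ → (s : P.Node) → ((∀ c, Fin (P.dim s c)) → ℂ) → ℝ
  | 0, s, v => if P.verdict s = some g then ∑ x, ‖v x‖ ^ 2 else 0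
  | n + 1, s, v =>
    match P.verdict s with
    | some g' => if g' = g then ∑ x, ‖v x‖ ^ 2 else 0
    | none => ∑ k, P.prob g n (P.next s k) (applyLocal (P.kraus s k) v)

/-- A family of unit vectors is perfectly discriminated by LOCC if some protocol, on the input of
any member of the family, announces that member with probability one. (The protocol may use
unboundedly many rounds; for one that always stops by round `N` the sequence is constant from
`N` on.) -/
def LOCCDiscriminable {κ : Type} [Fintype κ] [DecidableEq κ] {X : κ → Type}
    [∀ c, Fintype (X c)] [∀ c, DecidableEq (X c)] {G : Type} [DecidableEq G]
    (ψ : G → EuclideanSpace ℂ (∀ c, X c)) : Prop :=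
  ∃ P : LOCCProtocol κ X G, ∀ g,
    Filter.Tendsto (fun n => P.prob g n P.root (applyLocal P.init fun x => ψ g x))
      Filter.atTop (nhds 1)

/-- The parties `j : ι` come together in groups, `part j` being the group of `j`. The system of
group `c` is the tensor product of the systems of its members. This is the same vector, viewed
as a state of the groups. -/
def regroup {ι : Type} {X : ι → Type} {κ : Type} (part : ι → κ)
    (ψ : EuclideanSpace ℂ (∀ j, X j)) :
    EuclideanSpace ℂ (∀ c : κ, ∀ j : {j : ι // part j = c}, X j) :=
  WithLp.toLp 2 fun y => ψ fun j => y (part j) ⟨j, rfl⟩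

/-- Genuinely nonlocal set of product states in `⨂ j, ℂ^(d j)`: orthonormal fully product states
that cannot be perfectly discriminated by LOCC, however the parties come together in groups, as
long as they are not all in one group. -/
def IsGNPS {ι : Type} [Fintype ι] [DecidableEq ι] {d : ι → ℕ} {G : Type} [DecidableEq G]
    (ψ : G → EuclideanSpace ℂ (∀ j, Fin (d j))) : Prop :=
  (∀ g, ∃ φ : ∀ j, EuclideanSpace ℂ (Fin (d j)),
      (∀ j, ‖φ j‖ = 1) ∧ ψ g = productState φ) ∧
  Orthonormal ℂ ψ ∧
  ∀ (k : ℕ) (part : ι → Fin k), (∃ a b, part a ≠ part b) →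
    ¬ LOCCDiscriminable fun g => regroup part (ψ g)

/-- Alice (`none`) and the `m` Bobs (`some i`). -/
abbrev Party (m : ℕ) : Type := Option (Fin m)

/-- Alice holds `ℂ^(m+2)`, with basis `p, q, 1, …, m` numbered `0, 1, 2, …, m + 1`; the `i`-th Bob
holds `ℂ^3`, with basis `p, q, i` numbered `0, 1, 2`. -/
abbrev partyDim (m : ℕ) : Party m → ℕ
  | none => m + 2
  | some _ => 3

/-- The names of the states `ζ^0_±`, `ζ^{i,1}_±`, `ζ^{i,2}_±`, `ζ^{i,3}_±`, with sign `σ = ±1`. -/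
inductive StateLabel (m : ℕ) : Type
  | zeta0 (σ : ℤˣ)
  | zeta1 (i : Fin m) (σ : ℤˣ)
  | zeta2 (i : Fin m) (σ : ℤˣ)
  | zeta3 (i : Fin m) (σ : ℤˣ)
  deriving DecidableEq

/-- The basis vector `|a⟩` of `ℂ^n`. -/
def ket {n : ℕ} (a : Fin n) : EuclideanSpace ℂ (Fin n) := EuclideanSpace.single a 1

/-- `(|a⟩ + σ |b⟩) / √2`. -/
def superpose {n : ℕ} (σ : ℤˣ) (a b : Fin n) : EuclideanSpace ℂ (Fin n) :=
  ((1 / Real.sqrt 2 : ℝ) : ℂ) • (ket a + (((σ : ℤ) : ℂ)) • ket b)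

/-- Alice's tensor factor of each state. -/
def aliceFactor (m : ℕ) : StateLabel m → EuclideanSpace ℂ (Fin (m + 2))
  | .zeta0 σ => superpose σ 0 1
  | .zeta1 i _ => ket i.succ.succ
  | .zeta2 i σ => superpose σ 1 i.succ.succ
  | .zeta3 _ _ => ket 0

/-- The tensor factor of the `j`-th Bob in each state. -/
def bobFactor (m : ℕ) (j : Fin m) : StateLabel m → EuclideanSpace ℂ (Fin 3)
  | .zeta0 _ => ket 2
  | .zeta1 i σ => if j = i then superpose σ 1 2 else ket 2
  | .zeta2 i _ => if j = i then ket 0 else ket 2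
  | .zeta3 i σ => if j = i then superpose σ 0 1 else ket 2

/-- The states of `𝔾_{m+1}` in `ℂ^(m+2) ⊗ (ℂ^3)^{⊗ m}`. -/
def gState (m : ℕ) (g : StateLabel m) : EuclideanSpace ℂ (∀ j, Fin (partyDim m j)) :=
  productState fun
    | none => aliceFactor m g
    | some j => bobFactor m j g

/-- The grouping in which all the parties other than `j` come together. -/
def allBut {ι : Type} [DecidableEq ι] (j : ι) : ι → Fin 2 := fun i => if i = j then 0 else 1

end

/-!
If a protocol identifies every state of a family, then at each node the surviving unnormalized
states are still pairwise orthogonal: their overlap is bounded by the probabilities of failing from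
that node on. Some Bob is not in Alice's group, and she and this Bob share a copy of the domino
states, the remaining Bobs holding fixed vectors. A Kraus operator that keeps the domino states
orthogonal rescales all inner products of its owner's factors by one scalar, so by induction every
reachable node leaves the states locally equivalent to the initial ones, and a verdict announced
there would be announced for all of them alike.
-/

noncomputable section

open Filter

section Hilbert

variable {𝕜 V W U : Type*} [RCLike 𝕜] [NormedAddCommGroup V] [InnerProductSpace 𝕜 V]
  [NormedAddCommGroup W] [InnerProductSpace 𝕜 W] [NormedAddCommGroup U] [InnerProductSpace 𝕜 U]

/-- The operator `K` multiplies all inner products of vectors in `S` by one scalar. A measurement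
with such a Kraus operator reveals nothing about which member of `S` was measured. -/
def IsScaledIsometryOn (K : V →ₗ[𝕜] W) (S : Set V) : Prop :=
  ∃ z : 𝕜, ∀ u ∈ S, ∀ v ∈ S, inner 𝕜 (K u) (K v) = z * inner 𝕜 u v

namespace IsScaledIsometryOn

variable {K : V →ₗ[𝕜] W} {S T : Set V}

theorem mono (hK : IsScaledIsometryOn K T) (hST : S ⊆ T) : IsScaledIsometryOn K S := by
  obtain ⟨z, hz⟩ := hK
  exact ⟨z, fun u hu v hv => hz u (hST hu) v (hST hv)⟩

theorem of_subsingleton (hS : S.Subsingleton) : IsScaledIsometryOn K S := by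
  rcases hS.eq_empty_or_singleton with rfl | ⟨u, rfl⟩
  · exact ⟨0, by simp⟩
  · refine ⟨inner 𝕜 (K u) (K u) / inner 𝕜 u u, ?_⟩
    rintro _ rfl _ rfl
    exact (div_mul_cancel_of_imp fun h => by simp [inner_self_eq_zero.1 h]).symm

theorem span (hK : IsScaledIsometryOn K S) :
    IsScaledIsometryOn K (Submodule.span 𝕜 S : Set V) := by
  obtain ⟨z, hz⟩ := hK
  refine ⟨z, fun u hu v hv => ?_⟩
  induction hu, hv using Submodule.span_induction₂ with
  | mem_mem u v hu hv => exact hz u hu v hv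
  | zero_left | zero_right => simp
  | add_left _ _ _ _ _ _ h₁ h₂ => simp only [map_add, inner_add_left, h₁, h₂, mul_add]
  | add_right _ _ _ _ _ _ h₁ h₂ => simp only [map_add, inner_add_right, h₁, h₂, mul_add]
  | smul_left _ _ _ _ _ h => simp only [map_smul, inner_smul_left, h, mul_left_comm]
  | smul_right _ _ _ _ _ h => simp only [map_smul, inner_smul_right, h, mul_left_comm]

theorem comp_of_inner_map_map {A : W →ₗ[𝕜] U}
    (hA : ∀ x y, inner 𝕜 (A x) (A y) = inner 𝕜 x y) (hK : IsScaledIsometryOn K S) :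
    IsScaledIsometryOn (A ∘ₗ K) S := by
  obtain ⟨z, hz⟩ := hK
  exact ⟨z, fun u hu v hv => (hA _ _).trans (hz u hu v hv)⟩

theorem image_of_inner_map_map {A : U →ₗ[𝕜] V} {R : Set U} (hK : IsScaledIsometryOn (K ∘ₗ A) R)
    (hA : ∀ x y, inner 𝕜 (A x) (A y) = inner 𝕜 x y) : IsScaledIsometryOn K (A '' R) := by
  obtain ⟨z, hz⟩ := hK
  refine ⟨z, ?_⟩
  rintro _ ⟨u, hu, rfl⟩ _ ⟨v, hv, rfl⟩
  exact (hz u hu v hv).trans (by rw [hA])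

theorem inner_eq_zero_of_inner_map_map_eq_zero (hK : IsScaledIsometryOn K S) {t u v : V}
    (ht : t ∈ S) (hu : u ∈ S) (hv : v ∈ S) (hKt : K t ≠ 0) (h : inner 𝕜 (K u) (K v) = 0) :
    inner 𝕜 u v = 0 := by
  obtain ⟨z, hz⟩ := hK
  have hz0 : z ≠ 0 := by
    rintro rfl
    exact hKt (inner_self_eq_zero.1 ((hz t ht t ht).trans (zero_mul _)))
  exact (mul_eq_zero.1 ((hz u hu v hv).symm.trans h)).resolve_left hz0

theorem norm_map_eq_norm_map (hK : IsScaledIsometryOn K S) {u v : V} (hu : u ∈ S) (hv : v ∈ S)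
    (huv : ‖u‖ = ‖v‖) : ‖K u‖ = ‖K v‖ := by
  obtain ⟨z, hz⟩ := hK
  have h : inner 𝕜 (K u) (K u) = inner 𝕜 (K v) (K v) := by
    rw [hz u hu u hu, hz v hv v hv, inner_self_eq_norm_sq_to_K, inner_self_eq_norm_sq_to_K, huv]
  rw [norm_eq_sqrt_re_inner (𝕜 := 𝕜), h, ← norm_eq_sqrt_re_inner]

end IsScaledIsometryOn

end Hilbert

section KrausOperators

variable {𝕜 α β : Type*} [RCLike 𝕜] [Fintype α] [DecidableEq α] [Fintype β]

theorem inner_toEuclideanLin_toEuclideanLin (A : Matrix β α 𝕜) (u v : EuclideanSpace 𝕜 α) :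
    inner 𝕜 (A.toEuclideanLin u) (A.toEuclideanLin v) =
      inner 𝕜 u ((Aᴴ * A).toEuclideanLin v) := by
  classical
  rw [← LinearMap.adjoint_inner_right, ← Matrix.toEuclideanLin_conjTranspose_eq_adjoint]
  simp

theorem inner_toEuclideanLin_of_isometry {A : Matrix β α 𝕜} (hA : Aᴴ * A = 1)
    (u v : EuclideanSpace 𝕜 α) :
    inner 𝕜 (A.toEuclideanLin u) (A.toEuclideanLin v) = inner 𝕜 u v := by
  rw [inner_toEuclideanLin_toEuclideanLin, hA, Matrix.toLpLin_one, LinearMap.id_apply]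

theorem sum_inner_toEuclideanLin {N : Type*} [Fintype N] {β : N → Type*} [∀ k, Fintype (β k)]
    {M : ∀ k, Matrix (β k) α 𝕜} (hM : ∑ k, (M k)ᴴ * M k = 1) (u v : EuclideanSpace 𝕜 α) :
    ∑ k, inner 𝕜 ((M k).toEuclideanLin u) ((M k).toEuclideanLin v) = inner 𝕜 u v := by
  simp only [inner_toEuclideanLin_toEuclideanLin]
  rw [← inner_sum, ← LinearMap.sum_apply, ← map_sum, hM, Matrix.toLpLin_one, LinearMap.id_apply]

end KrausOperators

section PiKronecker

variable {κ R : Type*} [Fintype κ] [CommSemiring R] {X Y Z : κ → Type*}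

/-- The Kronecker product `⨂ c, A c` of a finite family of matrices. -/
def piKronecker (A : ∀ c, Matrix (Y c) (X c) R) : Matrix (∀ c, Y c) (∀ c, X c) R :=
  Matrix.of fun y x => ∏ c, A c (y c) (x c)

theorem piKronecker_conjTranspose [StarRing R] (A : ∀ c, Matrix (Y c) (X c) R) :
    (piKronecker A)ᴴ = piKronecker fun c => (A c)ᴴ := by
  ext x y
  simp [piKronecker, star_prod]

theorem piKronecker_mul [DecidableEq κ] [∀ c, Fintype (Y c)] (A : ∀ c, Matrix (Z c) (Y c) R)
    (B : ∀ c, Matrix (Y c) (X c) R) :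
    piKronecker A * piKronecker B = piKronecker fun c => A c * B c := by
  ext z x
  simp only [piKronecker, Matrix.mul_apply, Matrix.of_apply, ← Finset.prod_mul_distrib,
    Finset.prod_univ_sum, Fintype.piFinset_univ]

theorem piKronecker_one [∀ c, DecidableEq (X c)] [DecidableEq (∀ c, X c)] :
    piKronecker (fun c => (1 : Matrix (X c) (X c) R)) = 1 := by
  ext x x'
  simp [piKronecker, Matrix.one_apply, Finset.prod_ite_zero, funext_iff]

theorem piKronecker_apply_eq_mul_prod_erase [DecidableEq κ] (A : ∀ c, Matrix (Y c) (X c) R)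
    (a : κ) (y : ∀ c, Y c) (x : ∀ c, X c) :
    piKronecker A y x = A a (y a) (x a) * ∏ c ∈ Finset.univ.erase a, A c (y c) (x c) :=
  (Finset.mul_prod_erase _ (fun c => A c (y c) (x c)) (Finset.mem_univ a)).symm

theorem sum_piKronecker {N : Type*} [Fintype N] {A : N → ∀ c, Matrix (Y c) (X c) R}
    {B : ∀ c, Matrix (Y c) (X c) R} {a : κ} (ha : ∑ k, A k a = B a)
    (hB : ∀ k c, c ≠ a → A k c = B c) : ∑ k, piKronecker (A k) = piKronecker B := by
  classical
  ext y x
  rw [Matrix.sum_apply, piKronecker_apply_eq_mul_prod_erase B a, ← ha, Matrix.sum_apply,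
    Finset.sum_mul]
  refine Finset.sum_congr rfl fun k _ => ?_
  rw [piKronecker_apply_eq_mul_prod_erase _ a]
  congr 1
  exact Finset.prod_congr rfl fun c hc => by rw [hB k c (Finset.ne_of_mem_erase hc)]

theorem sum_conjTranspose_mul_piKronecker_eq_one [StarRing R] [DecidableEq κ]
    [∀ c, DecidableEq (X c)] [DecidableEq (∀ c, X c)] {N : Type*} [Fintype N]
    {Y : N → κ → Type*} [∀ k c, Fintype (Y k c)] {A : ∀ k c, Matrix (Y k c) (X c) R} {a : κ}
    (ha : ∑ k, (A k a)ᴴ * A k a = 1) (hA : ∀ k c, c ≠ a → (A k c)ᴴ * A k c = 1) :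
    ∑ k, (piKronecker (A k))ᴴ * piKronecker (A k) = 1 := by
  simp only [piKronecker_conjTranspose, piKronecker_mul]
  rw [sum_piKronecker (B := fun _ => 1) ha hA, piKronecker_one]

end PiKronecker

section ProductState

variable {ι : Type} [Fintype ι] [DecidableEq ι] {X Y : ι → Type} [∀ j, Fintype (X j)]

theorem inner_productState (u v : ∀ j, EuclideanSpace ℂ (X j)) :
    inner ℂ (productState u) (productState v) = ∏ j, inner ℂ (u j) (v j) := by
  simp only [PiLp.inner_apply, productState, RCLike.inner_apply, map_prod,
    ← Finset.prod_mul_distrib, Finset.prod_univ_sum, Fintype.piFinset_univ]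

theorem norm_productState (u : ∀ j, EuclideanSpace ℂ (X j)) :
    ‖productState u‖ = ∏ j, ‖u j‖ := by
  have h : ((‖productState u‖ ^ 2 : ℝ) : ℂ) = ((∏ j, ‖u j‖) ^ 2 : ℝ) := by
    have := inner_productState u u
    simp only [inner_self_eq_norm_sq_to_K] at this
    simpa [Finset.prod_pow] using this
  exact (pow_left_inj₀ (norm_nonneg _) (by positivity) two_ne_zero).1 (by exact_mod_cast h)

theorem norm_productState_eq_one {u : ∀ j, EuclideanSpace ℂ (X j)} (hu : ∀ j, ‖u j‖ = 1) :
    ‖productState u‖ = 1 :=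
  (norm_productState u).trans (Finset.prod_eq_one fun j _ => hu j)

theorem toEuclideanLin_piKronecker_productState [∀ j, DecidableEq (X j)]
    [DecidableEq (∀ j, X j)] (A : ∀ j, Matrix (Y j) (X j) ℂ) (u : ∀ j, EuclideanSpace ℂ (X j)) :
    (piKronecker A).toEuclideanLin (productState u) =
      productState fun j => (A j).toEuclideanLin (u j) := by
  ext y
  simp only [productState, piKronecker, Matrix.toLpLin_apply, Matrix.mulVec, dotProduct,
    Matrix.of_apply, ← Finset.prod_mul_distrib, Finset.prod_univ_sum, Fintype.piFinset_univ]

end ProductState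

theorem regroup_productState {ι κ : Type} [Fintype ι] {X : ι → Type} [Fintype κ]
    [DecidableEq κ] (part : ι → κ) (u : ∀ j, EuclideanSpace ℂ (X j)) :
    regroup part (productState u) =
      productState fun c => productState fun j : {j // part j = c} => u j := by
  ext y
  simp only [regroup, productState]
  rw [← Fintype.prod_fiberwise part]
  refine Finset.prod_congr rfl fun c _ => Finset.prod_congr rfl fun j _ => ?_
  obtain ⟨j, rfl⟩ := j
  rfl

namespace LOCCProtocol

variable {κ : Type} [Fintype κ] [DecidableEq κ] {X : κ → Type} [∀ c, Fintype (X c)]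
  [∀ c, DecidableEq (X c)] {G : Type} (P : LOCCProtocol κ X G)

/-- The effect of outcome `k` at node `s` on the joint state of all the parties. -/
def step (s : P.Node) (k : Fin (P.outcomes s)) :
    EuclideanSpace ℂ (∀ c, Fin (P.dim s c)) →ₗ[ℂ]
      EuclideanSpace ℂ (∀ c, Fin (P.dim (P.next s k) c)) :=
  (piKronecker (P.kraus s k)).toEuclideanLin

theorem sum_inner_step (s : P.Node) (u v : EuclideanSpace ℂ (∀ c, Fin (P.dim s c))) :
    ∑ k, inner ℂ (P.step s k u) (P.step s k v) = inner ℂ u v :=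
  sum_inner_toEuclideanLin
    (sum_conjTranspose_mul_piKronecker_eq_one (P.kraus_complete s) (P.kraus_isometry s)) u v

theorem sum_norm_sq_step (s : P.Node) (v : EuclideanSpace ℂ (∀ c, Fin (P.dim s c))) :
    ∑ k, ‖P.step s k v‖ ^ 2 = ‖v‖ ^ 2 := by
  have h := P.sum_inner_step s v v
  simp only [inner_self_eq_norm_sq_to_K] at h
  exact_mod_cast h

theorem step_productState (s : P.Node) (k : Fin (P.outcomes s))
    (u : ∀ c, EuclideanSpace ℂ (Fin (P.dim s c))) :
    P.step s k (productState u) = productState fun c => (P.kraus s k c).toEuclideanLin (u c) :=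
  toEuclideanLin_piKronecker_productState _ _

variable [DecidableEq G]

theorem prob_zero_of_verdict_eq_none {s : P.Node} (hs : P.verdict s = none) (g : G)
    (v : EuclideanSpace ℂ (∀ c, Fin (P.dim s c))) : P.prob g 0 s v = 0 := by
  simp [prob, hs]

theorem prob_succ_of_verdict_eq_none {s : P.Node} (hs : P.verdict s = none) (g : G) (n : ℕ)
    (v : EuclideanSpace ℂ (∀ c, Fin (P.dim s c))) :
    P.prob g (n + 1) s v = ∑ k, P.prob g n (P.next s k) (P.step s k v) := by
  rw [prob, hs]
  rfl

theorem prob_of_verdict_eq_some {s : P.Node} {g' : G} (hs : P.verdict s = some g') (g : G) (n : ℕ)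
    (v : EuclideanSpace ℂ (∀ c, Fin (P.dim s c))) :
    P.prob g n s v = if g' = g then ‖v‖ ^ 2 else 0 := by
  rw [EuclideanSpace.norm_sq_eq]
  cases n with
  | zero => simp [prob, hs]
  | succ n => rw [prob, hs]

theorem prob_le_norm_sq (g : G) (n : ℕ) (s : P.Node)
    (v : EuclideanSpace ℂ (∀ c, Fin (P.dim s c))) : P.prob g n s v ≤ ‖v‖ ^ 2 := by
  induction n generalizing s with
  | zero =>
    rcases hs : P.verdict s with _ | g'
    · rw [P.prob_zero_of_verdict_eq_none hs]
      positivity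
    · rw [P.prob_of_verdict_eq_some hs]
      split_ifs <;> simp
  | succ n ih =>
    rcases hs : P.verdict s with _ | g'
    · rw [P.prob_succ_of_verdict_eq_none hs, ← P.sum_norm_sq_step s v]
      exact Finset.sum_le_sum fun k _ => ih _ _
    · rw [P.prob_of_verdict_eq_some hs]
      split_ifs <;> simp

/-- The probability that the protocol, started at node `s` with the unnormalized state `v`, does
not announce `g` within `n` rounds: it announces something else or is still running. -/
def errorProb (g : G) (n : ℕ) (s : P.Node) (v : EuclideanSpace ℂ (∀ c, Fin (P.dim s c))) : ℝ :=
  ‖v‖ ^ 2 - P.prob g n s v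

theorem errorProb_nonneg (g : G) (n : ℕ) (s : P.Node)
    (v : EuclideanSpace ℂ (∀ c, Fin (P.dim s c))) : 0 ≤ P.errorProb g n s v :=
  sub_nonneg.2 (P.prob_le_norm_sq g n s v)

theorem errorProb_succ_of_verdict_eq_none {s : P.Node} (hs : P.verdict s = none) (g : G) (n : ℕ)
    (v : EuclideanSpace ℂ (∀ c, Fin (P.dim s c))) :
    P.errorProb g (n + 1) s v = ∑ k, P.errorProb g n (P.next s k) (P.step s k v) := by
  simp only [errorProb, Finset.sum_sub_distrib, P.sum_norm_sq_step,
    P.prob_succ_of_verdict_eq_none hs]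

theorem norm_inner_le_of_prob_eq_zero {g h : G} {n : ℕ} {s : P.Node}
    {u v : EuclideanSpace ℂ (∀ c, Fin (P.dim s c))}
    (huv : P.prob g n s u = 0 ∨ P.prob h n s v = 0) :
    ‖inner ℂ u v‖ ≤ √(P.errorProb g n s u) * ‖v‖ + ‖u‖ * √(P.errorProb h n s v) := by
  refine (norm_inner_le_norm u v).trans ?_
  rcases huv with h0 | h0
  · rw [errorProb, h0, sub_zero, Real.sqrt_sq (norm_nonneg u)]
    exact le_add_of_nonneg_right (by positivity)
  · rw [errorProb.eq_def P h, h0, sub_zero, Real.sqrt_sq (norm_nonneg v)]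
    exact le_add_of_nonneg_left (by positivity)

theorem sum_sqrt_errorProb_mul_norm_step_le {s : P.Node} (hs : P.verdict s = none) (g : G) (n : ℕ)
    (u v : EuclideanSpace ℂ (∀ c, Fin (P.dim s c))) :
    ∑ k, √(P.errorProb g n (P.next s k) (P.step s k u)) * ‖P.step s k v‖ ≤
      √(P.errorProb g (n + 1) s u) * ‖v‖ := by
  have norm_eq : ‖v‖ = √(∑ k, ‖P.step s k v‖ ^ 2) := by
    rw [P.sum_norm_sq_step, Real.sqrt_sq (norm_nonneg v)]
  rw [P.errorProb_succ_of_verdict_eq_none hs, norm_eq]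
  simpa only [Real.sqrt_sq (norm_nonneg _)] using
    Real.sum_sqrt_mul_sqrt_le Finset.univ
      (f := fun k => P.errorProb g n (P.next s k) (P.step s k u))
      (g := fun k => ‖P.step s k v‖ ^ 2)
      (fun k => P.errorProb_nonneg _ _ _ _) fun k => sq_nonneg _

theorem norm_inner_le {g h : G} (hgh : g ≠ h) (n : ℕ) (s : P.Node)
    (u v : EuclideanSpace ℂ (∀ c, Fin (P.dim s c))) :
    ‖inner ℂ u v‖ ≤ √(P.errorProb g n s u) * ‖v‖ + ‖u‖ * √(P.errorProb h n s v) := by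
  have verdict_case {n s u v} {g' : G} (hs : P.verdict s = some g') :
      ‖inner ℂ u v‖ ≤ √(P.errorProb g n s u) * ‖v‖ + ‖u‖ * √(P.errorProb h n s v) := by
    refine P.norm_inner_le_of_prob_eq_zero ?_
    rw [P.prob_of_verdict_eq_some hs, P.prob_of_verdict_eq_some hs]
    by_cases hg : g' = g
    · exact Or.inr (if_neg (hg ▸ hgh))
    · exact Or.inl (if_neg hg)
  induction n generalizing s with
  | zero =>
    rcases hs : P.verdict s with _ | g'
    · exact P.norm_inner_le_of_prob_eq_zero (Or.inl (P.prob_zero_of_verdict_eq_none hs g u))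
    · exact verdict_case hs
  | succ n ih =>
    rcases hs : P.verdict s with _ | g'
    · calc ‖inner ℂ u v‖
          ≤ ∑ k, ‖inner ℂ (P.step s k u) (P.step s k v)‖ := by
            rw [← P.sum_inner_step]
            exact norm_sum_le _ _
        _ ≤ ∑ k, √(P.errorProb g n _ (P.step s k u)) * ‖P.step s k v‖ +
              ∑ k, √(P.errorProb h n _ (P.step s k v)) * ‖P.step s k u‖ := by
            rw [← Finset.sum_add_distrib]
            exact Finset.sum_le_sum fun k _ => (ih _ _ _).trans_eq (by ring)
        _ ≤ √(P.errorProb g (n + 1) s u) * ‖v‖ + √(P.errorProb h (n + 1) s v) * ‖u‖ :=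
            add_le_add (P.sum_sqrt_errorProb_mul_norm_step_le hs g n u v)
              (P.sum_sqrt_errorProb_mul_norm_step_le hs h n v u)
        _ = √(P.errorProb g (n + 1) s u) * ‖v‖ + ‖u‖ * √(P.errorProb h (n + 1) s v) := by ring
    · exact verdict_case hs

/-- Started at node `s` with the unnormalized state `v`, the protocol announces `g` with
certainty, in the limit of infinitely many rounds. -/
def Identifies (g : G) (s : P.Node) (v : EuclideanSpace ℂ (∀ c, Fin (P.dim s c))) : Prop :=
  Tendsto (fun n => P.errorProb g n s v) atTop (nhds 0)

namespace Identifies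

variable {P} {g h : G} {s : P.Node} {u v : EuclideanSpace ℂ (∀ c, Fin (P.dim s c))}

theorem inner_eq_zero (hgh : g ≠ h) (hu : P.Identifies g s u) (hv : P.Identifies h s v) :
    inner ℂ u v = 0 := by
  have hlim : Tendsto (fun n => √(P.errorProb g n s u) * ‖v‖ + ‖u‖ * √(P.errorProb h n s v))
      atTop (nhds 0) := by
    simpa using (hu.sqrt.mul_const ‖v‖).add (hv.sqrt.const_mul ‖u‖)
  exact norm_le_zero_iff.1 (ge_of_tendsto' hlim fun n => P.norm_inner_le hgh n s u v)

theorem step (hv : P.Identifies g s v) (hs : P.verdict s = none) (k : Fin (P.outcomes s)) :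
    P.Identifies g (P.next s k) (P.step s k v) := by
  refine squeeze_zero (fun n => P.errorProb_nonneg _ _ _ _) (fun n => ?_)
    ((tendsto_add_atTop_iff_nat 1).2 hv)
  rw [P.errorProb_succ_of_verdict_eq_none hs]
  exact Finset.single_le_sum
    (f := fun k => P.errorProb g n (P.next s k) (P.step s k v))
    (fun k _ => P.errorProb_nonneg _ _ _ _) (Finset.mem_univ k)

theorem eq_zero_of_prob_nonpos (hv : P.Identifies g s v) (h : ∀ n, P.prob g n s v ≤ 0) :
    v = 0 := by
  have hle : ‖v‖ ^ 2 ≤ 0 := ge_of_tendsto' hv fun n => le_sub_self_iff _ |>.2 (h n)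
  simpa using hle.antisymm (sq_nonneg ‖v‖)

theorem eq_zero_of_verdict_ne (hv : P.Identifies g s v) (hs : P.verdict s = some h)
    (hgh : g ≠ h) : v = 0 :=
  hv.eq_zero_of_prob_nonpos fun n => by rw [P.prob_of_verdict_eq_some hs, if_neg hgh.symm]

end Identifies

end LOCCProtocol

section LocalStability

variable {κ : Type} {X : κ → Type} [∀ c, Fintype (X c)] {D : Type*}

/-- Local stability of the product states `⨂ c, w d c`: if one party `c` measures and the states
remain orthogonal (each pair through the images at `c` or through the factors of another party),
then its Kraus operator `K` reveals nothing. Only the action of `K` on the factors `w d c` matters,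
as the rest of the local space need not be used by the family. -/
def IsLocallyStable (w : D → ∀ c, EuclideanSpace ℂ (X c)) : Prop :=
  ∀ (c : κ) (n : ℕ) (K : EuclideanSpace ℂ (X c) →ₗ[ℂ] EuclideanSpace ℂ (Fin n)),
    (∀ d d', d ≠ d' → inner ℂ (K (w d c)) (K (w d' c)) = 0 ∨
      ∃ c' ≠ c, inner ℂ (w d c') (w d' c') = 0) →
    IsScaledIsometryOn K (Set.range fun d => w d c)

variable [Fintype κ] [DecidableEq κ] {w : D → ∀ c, EuclideanSpace ℂ (X c)}

theorem norm_productState_map_eq {Y : κ → Type} [∀ c, Fintype (Y c)]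
    {T : ∀ c, EuclideanSpace ℂ (X c) →ₗ[ℂ] EuclideanSpace ℂ (Y c)}
    (hT : ∀ c, IsScaledIsometryOn (T c) (Set.range fun d => w d c)) (hw : ∀ d c, ‖w d c‖ = 1)
    (d d' : D) :
    ‖productState fun c => T c (w d c)‖ = ‖productState fun c => T c (w d' c)‖ := by
  simp only [norm_productState]
  exact Finset.prod_congr rfl fun c _ =>
    (hT c).norm_map_eq_norm_map ⟨d, rfl⟩ ⟨d', rfl⟩ ((hw d c).trans (hw d' c).symm)

theorem IsLocallyStable.isScaledIsometryOn_comp (hw : IsLocallyStable w) {n n' : κ → ℕ}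
    {T : ∀ c, EuclideanSpace ℂ (X c) →ₗ[ℂ] EuclideanSpace ℂ (Fin (n c))}
    {A : ∀ c, EuclideanSpace ℂ (Fin (n c)) →ₗ[ℂ] EuclideanSpace ℂ (Fin (n' c))} {a : κ}
    (hT : ∀ c, IsScaledIsometryOn (T c) (Set.range fun d => w d c))
    (hA : ∀ c ≠ a, ∀ x y, inner ℂ (A c x) (A c y) = inner ℂ x y)
    {e : D} (he : productState (fun c => T c (w e c)) ≠ 0)
    (horth : ∀ d d', d ≠ d' → inner ℂ (productState fun c => A c (T c (w d c)))
      (productState fun c => A c (T c (w d' c))) = 0) (c : κ) :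
    IsScaledIsometryOn (A c ∘ₗ T c) (Set.range fun d => w d c) := by
  rcases ne_or_eq c a with hca | rfl
  · exact (hT c).comp_of_inner_map_map (hA c hca)
  have hTe (c' : κ) : T c' (w e c') ≠ 0 := by
    rw [← norm_ne_zero_iff, norm_productState, Finset.prod_ne_zero_iff] at he
    exact norm_ne_zero_iff.1 (he c' (Finset.mem_univ c'))
  refine hw c _ _ fun d d' hd => ?_
  have hprod := horth d d' hd
  rw [inner_productState, Finset.prod_eq_zero_iff] at hprod
  obtain ⟨c', -, hc'⟩ := hprod
  rcases eq_or_ne c' c with rfl | hne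
  · exact Or.inl hc'
  · rw [hA c' hne] at hc'
    exact Or.inr ⟨c', hne, (hT c').inner_eq_zero_of_inner_map_map_eq_zero
      ⟨e, rfl⟩ ⟨d, rfl⟩ ⟨d', rfl⟩ (hTe c') hc'⟩

variable [∀ c, DecidableEq (X c)] {G : Type} [DecidableEq G]

theorem IsLocallyStable.prob_nonpos [Nontrivial D] (hw : IsLocallyStable w)
    (hunit : ∀ d c, ‖w d c‖ = 1) {P : LOCCProtocol κ X G} {label : D → G}
    (hlabel : label.Injective) (g : G) (d : D) (n : ℕ) (s : P.Node)
    (T : ∀ c, EuclideanSpace ℂ (X c) →ₗ[ℂ] EuclideanSpace ℂ (Fin (P.dim s c)))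
    (hT : ∀ c, IsScaledIsometryOn (T c) (Set.range fun d => w d c))
    (hid : ∀ d, P.Identifies (label d) s (productState fun c => T c (w d c))) :
    P.prob g n s (productState fun c => T c (w d c)) ≤ 0 := by
  by_cases hd : productState (fun c => T c (w d c)) = 0
  · simpa [hd] using P.prob_le_norm_sq g n s (productState fun c => T c (w d c))
  rcases hs : P.verdict s with _ | g'
  · cases n with
    | zero => exact (P.prob_zero_of_verdict_eq_none hs g _).le
    | succ n =>
      rw [P.prob_succ_of_verdict_eq_none hs]
      refine Finset.sum_nonpos fun k _ => ?_
      have hid' (d : D) := (hid d).step hs k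
      simp only [P.step_productState] at hid' ⊢
      have hT' := hw.isScaledIsometryOn_comp hT
        (fun c hc => inner_toEuclideanLin_of_isometry (P.kraus_isometry s k c hc)) hd
        fun d d' hdd' => (hid' d).inner_eq_zero (hlabel.ne hdd') (hid' d')
      exact hw.prob_nonpos hunit hlabel g d n _ _ hT' hid'
  · obtain ⟨d', hd'⟩ : ∃ d', label d' ≠ g' := by
      obtain ⟨d₁, d₂, hne⟩ := exists_pair_ne D
      by_contra! h
      exact hne (hlabel ((h d₁).trans (h d₂).symm))
    have hzero := (hid d').eq_zero_of_verdict_ne hs hd'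
    exact absurd (norm_eq_zero.1 ((norm_productState_map_eq hT hunit d d').trans
      (norm_eq_zero.2 hzero))) hd

theorem IsLocallyStable.not_loccDiscriminable [Nontrivial D] (hw : IsLocallyStable w)
    (hunit : ∀ d c, ‖w d c‖ = 1) {label : D → G} (hlabel : label.Injective)
    {ψ : G → EuclideanSpace ℂ (∀ c, X c)} (hψ : ∀ d, ψ (label d) = productState (w d)) :
    ¬ LOCCDiscriminable ψ := by
  rintro ⟨P, hP⟩
  have hinit (c : κ) := inner_toEuclideanLin_of_isometry (P.init_isometry c)
  have hT (c : κ) : IsScaledIsometryOn (P.init c).toEuclideanLin (Set.range fun d => w d c) :=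
    ⟨1, fun u _ v _ => (hinit c u v).trans (one_mul _).symm⟩
  have hnorm (d : D) : ‖productState fun c => (P.init c).toEuclideanLin (w d c)‖ = 1 :=
    norm_productState_eq_one fun c =>
      (((P.init c).toEuclideanLin.isometryOfInner (hinit c)).norm_map _).trans (hunit d c)
  have hid (d : D) :
      P.Identifies (label d) P.root (productState fun c => (P.init c).toEuclideanLin (w d c)) := by
    have h := (hP (label d)).const_sub 1
    rw [hψ d, sub_self] at h
    simp only [LOCCProtocol.Identifies, LOCCProtocol.errorProb, hnorm, one_pow]
    rw [← toEuclideanLin_piKronecker_productState]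
    exact h
  obtain ⟨d⟩ := Nontrivial.to_nonempty (α := D)
  have hzero := (hid d).eq_zero_of_prob_nonpos fun n =>
    hw.prob_nonpos hunit hlabel _ d n _ _ hT hid
  simpa [hzero] using hnorm d

end LocalStability

section Grouping

variable {ι : Type} [Fintype ι] [DecidableEq ι] {X : ι → Type}

theorem productState_update_apply (f : ∀ j, EuclideanSpace ℂ (X j)) (j : ι)
    (x : EuclideanSpace ℂ (X j)) (y : ∀ j, X j) :
    productState (Function.update f j x) y = x (y j) * ∏ i ∈ Finset.univ.erase j, f i (y i) := by
  change ∏ i, Function.update f j x i (y i) = _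
  rw [← Finset.mul_prod_erase _ _ (Finset.mem_univ j), Function.update_self]
  congr 1
  exact Finset.prod_congr rfl fun i hi => by
    rw [Function.update_of_ne (Finset.ne_of_mem_erase hi)]

/-- The embedding of the system of party `j` into the joint system in which every other party
`i` holds the fixed vector `f i`. -/
def insertFactor (f : ∀ j, EuclideanSpace ℂ (X j)) (j : ι) :
    EuclideanSpace ℂ (X j) →ₗ[ℂ] EuclideanSpace ℂ (∀ j, X j) where
  toFun x := productState (Function.update f j x)
  map_add' x x' := by
    ext y
    simp only [productState_update_apply, PiLp.add_apply, add_mul]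
  map_smul' r x := by
    ext y
    simp only [productState_update_apply, PiLp.smul_apply, smul_eq_mul, RingHom.id_apply, mul_assoc]

theorem insertFactor_apply_of_eq {f u : ∀ j, EuclideanSpace ℂ (X j)} {j : ι}
    (h : ∀ i ≠ j, f i = u i) : insertFactor f j (u j) = productState u :=
  congrArg productState (Function.update_eq_iff.2 ⟨rfl, h⟩)

variable [∀ j, Fintype (X j)]

theorem inner_insertFactor_insertFactor {f : ∀ j, EuclideanSpace ℂ (X j)} {j : ι}
    (hf : ∀ i ≠ j, ‖f i‖ = 1) (x x' : EuclideanSpace ℂ (X j)) :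
    inner ℂ (insertFactor f j x) (insertFactor f j x') = inner ℂ x x' := by
  change inner ℂ (productState (Function.update f j x)) (productState (Function.update f j x')) = _
  rw [inner_productState, Fintype.prod_eq_single j, Function.update_self, Function.update_self]
  intro i hi
  rw [Function.update_of_ne hi, Function.update_of_ne hi, inner_self_eq_norm_sq_to_K, hf i hi]
  simp

theorem IsLocallyStable.regroup {D : Type*} {w : D → ∀ j, EuclideanSpace ℂ (X j)}
    (hw : IsLocallyStable w) (hunit : ∀ d j, ‖w d j‖ = 1) {κ : Type} [DecidableEq κ]
    (part : ι → κ)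
    (hpart : ∀ i j, i ≠ j → part i = part j →
      (∀ d d', w d i = w d' i) ∨ ∀ d d', w d j = w d' j) :
    IsLocallyStable fun d c => productState fun j : {j // part j = c} => w d j := by
  intro c n K horth
  by_cases hconst : ∀ (j : {j // part j = c}) (d d' : D), w d j = w d' j
  · refine IsScaledIsometryOn.of_subsingleton ?_
    rintro _ ⟨d, rfl⟩ _ ⟨d', rfl⟩
    exact congrArg productState (funext fun j => hconst j d d')
  push Not at hconst
  obtain ⟨j, e, e', hee'⟩ := hconst
  let I := insertFactor (fun i : {i // part i = c} => w e i) j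
  have hI (d : D) : I (w d j) = productState fun i : {i // part i = c} => w d i := by
    refine insertFactor_apply_of_eq (u := fun i : {i // part i = c} => w d i) fun i hi => ?_
    exact (hpart i j (Subtype.coe_ne_coe.2 hi) (i.2.trans j.2.symm)).resolve_right
      (fun h => hee' (h e e')) e d
  have hKI : IsScaledIsometryOn (K ∘ₗ I) (Set.range fun d => w d j) := by
    refine hw j n _ fun d d' hdd' => ?_
    simp only [LinearMap.comp_apply, hI]
    refine (horth d d' hdd').imp_right ?_
    rintro ⟨c', hc', h⟩
    rw [inner_productState, Finset.prod_eq_zero_iff] at h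
    obtain ⟨i, -, hi⟩ := h
    exact ⟨i, fun hij => hc' (by rw [← i.2, hij, j.2]), hi⟩
  refine (hKI.image_of_inner_map_map (inner_insertFactor_insertFactor fun _ _ => hunit e _)).mono ?_
  rintro _ ⟨d, rfl⟩
  exact ⟨w d j, ⟨d, rfl⟩, hI d⟩

end Grouping

section Kets

variable {n : ℕ} {a b c : Fin n} {σ τ : ℤˣ}

theorem norm_ket (a : Fin n) : ‖ket a‖ = 1 := by simp [ket]

theorem ket_ne_zero (a : Fin n) : ket a ≠ 0 := by simp [ket]

theorem inner_ket_ket (a b : Fin n) : inner ℂ (ket a) (ket b) = if a = b then (1 : ℂ) else 0 := by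
  simp [ket, EuclideanSpace.inner_single_left]

theorem inner_ket_superpose (σ : ℤˣ) (a b c : Fin n) :
    inner ℂ (ket c) (superpose σ a b) =
      ((1 / √2 : ℝ) : ℂ) * ((if c = a then 1 else 0) + ((σ : ℤ) : ℂ) * if c = b then 1 else 0) := by
  simp only [superpose, inner_smul_right, inner_add_right, inner_ket_ket]

theorem inner_ket_superpose_of_ne (hca : c ≠ a) (hcb : c ≠ b) :
    inner ℂ (ket c) (superpose σ a b) = 0 := by
  simp [inner_ket_superpose, hca, hcb]

theorem inner_ket_left_superpose_ne_zero (hab : a ≠ b) :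
    inner ℂ (ket a) (superpose σ a b) ≠ 0 := by
  simp [inner_ket_superpose, hab]

theorem inner_ket_right_superpose_ne_zero (hab : a ≠ b) :
    inner ℂ (ket b) (superpose σ a b) ≠ 0 := by
  simp [inner_ket_superpose, hab.symm]

theorem inner_superpose_superpose (hab : a ≠ b) :
    inner ℂ (superpose σ a b) (superpose τ a b) = (1 + ((σ : ℤ) : ℂ) * ((τ : ℤ) : ℂ)) / 2 := by
  have hsqrt : ((1 / √2 : ℝ) : ℂ) * ((1 / √2 : ℝ) : ℂ) = 1 / 2 := by
    rw [← Complex.ofReal_mul, div_mul_div_comm, Real.mul_self_sqrt zero_le_two]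
    norm_num
  rw [superpose, inner_smul_left, inner_add_left, inner_smul_left, inner_ket_superpose,
    inner_ket_superpose, Complex.conj_ofReal, map_intCast]
  simp only [hab, hab.symm, if_true, if_false, mul_one, mul_zero, add_zero, zero_add]
  linear_combination (1 + ((σ : ℤ) : ℂ) * ((τ : ℤ) : ℂ)) * hsqrt

theorem norm_superpose (σ : ℤˣ) (hab : a ≠ b) : ‖superpose σ a b‖ = 1 := by
  rw [norm_eq_sqrt_re_inner (𝕜 := ℂ), inner_superpose_superpose hab]
  rcases Int.units_eq_one_or σ with rfl | rfl <;> norm_num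

theorem inner_superpose_superpose_of_ne (hab : a ≠ b) (hστ : σ ≠ τ) :
    inner ℂ (superpose σ a b) (superpose τ a b) = 0 := by
  rw [inner_superpose_superpose hab, Int.units_ne_iff_eq_neg.1 hστ]
  rcases Int.units_eq_one_or τ with rfl | rfl <;> simp

theorem superpose_mem_span {S : Set (EuclideanSpace ℂ (Fin n))} (ha : ket a ∈ S)
    (hb : ket b ∈ S) (σ : ℤˣ) : superpose σ a b ∈ Submodule.span ℂ S :=
  Submodule.smul_mem _ _ (add_mem (Submodule.subset_span ha)
    (Submodule.smul_mem _ _ (Submodule.subset_span hb)))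

end Kets

section Domino

variable {n : ℕ} {a b c : Fin n} {W : Type*} [NormedAddCommGroup W] [InnerProductSpace ℂ W]
  {K : EuclideanSpace ℂ (Fin n) →ₗ[ℂ] W}

theorem inner_map_superpose (w : W) (σ : ℤˣ) :
    inner ℂ w (K (superpose σ a b)) =
      ((1 / √2 : ℝ) : ℂ) * (inner ℂ w (K (ket a)) + ((σ : ℤ) : ℂ) * inner ℂ w (K (ket b))) := by
  simp only [superpose, map_smul, map_add, inner_smul_right, inner_add_right]

theorem inner_map_ket_eq_zero_of_superpose {w : W}
    (h : ∀ σ, inner ℂ w (K (superpose σ a b)) = 0) :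
    inner ℂ w (K (ket a)) = 0 ∧ inner ℂ w (K (ket b)) = 0 := by
  simp only [inner_map_superpose, mul_eq_zero, Complex.ofReal_eq_zero] at h
  have hsqrt : 1 / √2 ≠ 0 := by positivity
  have hadd := (h 1).resolve_left hsqrt
  have hsub := (h (-1)).resolve_left hsqrt
  push_cast at hadd hsub
  exact ⟨by linear_combination (hadd + hsub) / 2, by linear_combination (hadd - hsub) / 2⟩

theorem inner_map_ket_self_eq (hab : inner ℂ (K (ket a)) (K (ket b)) = 0)
    (h : inner ℂ (K (superpose 1 a b)) (K (superpose (-1) a b)) = 0) :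
    inner ℂ (K (ket a)) (K (ket a)) = inner ℂ (K (ket b)) (K (ket b)) := by
  have hba := inner_eq_zero_symm.1 hab
  simp only [superpose, map_smul, map_add, inner_smul_left, inner_smul_right, inner_add_left,
    inner_add_right, hab, hba] at h
  simpa [add_neg_eq_zero] using h

theorem isScaledIsometryOn_ket_triple (hab : a ≠ b) (hbc : b ≠ c) (hac : a ≠ c)
    (h₁ : inner ℂ (K (superpose 1 a b)) (K (superpose (-1) a b)) = 0)
    (h₂ : inner ℂ (K (superpose 1 b c)) (K (superpose (-1) b c)) = 0)
    (h₃ : ∀ σ, inner ℂ (K (ket a)) (K (superpose σ b c)) = 0)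
    (h₄ : ∀ σ, inner ℂ (K (ket c)) (K (superpose σ a b)) = 0) :
    IsScaledIsometryOn K {ket a, ket b, ket c} := by
  obtain ⟨hKab, hKac⟩ := inner_map_ket_eq_zero_of_superpose h₃
  obtain ⟨hKca, hKcb⟩ := inner_map_ket_eq_zero_of_superpose h₄
  have hKba := inner_eq_zero_symm.1 hKab
  have hKbc := inner_eq_zero_symm.1 hKcb
  have hKaa := inner_map_ket_self_eq hKab h₁
  have hKbb := inner_map_ket_self_eq hKbc h₂
  refine ⟨inner ℂ (K (ket c)) (K (ket c)), ?_⟩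
  rintro _ (rfl | rfl | rfl) _ (rfl | rfl | rfl) <;>
    simp only [inner_ket_ket, *, hab.symm, hbc.symm, hac.symm, if_true, if_false, mul_one, mul_zero]

end Domino

section GStates

variable {m : ℕ}

/-- The tensor factors of the states of `𝔾_{m+1}`. -/
def gFactor (m : ℕ) (g : StateLabel m) : ∀ j : Party m, EuclideanSpace ℂ (Fin (partyDim m j))
  | none => aliceFactor m g
  | some j => bobFactor m j g

theorem gState_eq_productState_gFactor (g : StateLabel m) :
    gState m g = productState (gFactor m g) := rfl

theorem one_ne_succ_succ (i : Fin m) : (1 : Fin (m + 2)) ≠ i.succ.succ := by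
  rw [← Fin.succ_zero_eq_one', Ne, Fin.succ_inj]
  exact (Fin.succ_ne_zero i).symm

theorem norm_aliceFactor (g : StateLabel m) : ‖aliceFactor m g‖ = 1 := by
  rcases g with σ | ⟨_, _⟩ | ⟨i, σ⟩ | ⟨_, _⟩
  · exact norm_superpose σ (by simp)
  · exact norm_ket _
  · exact norm_superpose σ (one_ne_succ_succ i)
  · exact norm_ket _

theorem norm_bobFactor (j : Fin m) (g : StateLabel m) : ‖bobFactor m j g‖ = 1 := by
  rcases g with σ | ⟨i, σ⟩ | ⟨i, σ⟩ | ⟨i, σ⟩ <;> simp only [bobFactor]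
  · exact norm_ket _
  all_goals split_ifs
  exacts [norm_superpose σ (by decide), norm_ket _, norm_ket _, norm_ket _,
    norm_superpose σ (by decide), norm_ket _]

theorem norm_gFactor (g : StateLabel m) : ∀ j, ‖gFactor m g j‖ = 1
  | none => norm_aliceFactor g
  | some j => norm_bobFactor j g

/-- The two states are orthogonal at some party. -/
def HaveOrthogonalFactor (g h : StateLabel m) : Prop :=
  ∃ j, inner ℂ (gFactor m g j) (gFactor m h j) = 0

namespace HaveOrthogonalFactor

theorem symm {g h : StateLabel m} : HaveOrthogonalFactor g h → HaveOrthogonalFactor h g :=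
  Exists.imp fun _ => inner_eq_zero_symm.1

theorem zeta0_zeta0 {σ τ : ℤˣ} (h : σ ≠ τ) :
    HaveOrthogonalFactor (.zeta0 σ : StateLabel m) (.zeta0 τ) :=
  ⟨none, inner_superpose_superpose_of_ne (by simp) h⟩

theorem zeta0_zeta1 (σ : ℤˣ) (j : Fin m) (τ : ℤˣ) :
    HaveOrthogonalFactor (.zeta0 σ) (.zeta1 j τ) :=
  symm ⟨none, inner_ket_superpose_of_ne (Fin.succ_ne_zero _) (one_ne_succ_succ j).symm⟩

theorem zeta0_zeta2 (σ : ℤˣ) (j : Fin m) (τ : ℤˣ) :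
    HaveOrthogonalFactor (.zeta0 σ) (.zeta2 j τ) :=
  ⟨some j, by simp [gFactor, bobFactor, inner_ket_ket]⟩

theorem zeta0_zeta3 (σ : ℤˣ) (j : Fin m) (τ : ℤˣ) :
    HaveOrthogonalFactor (.zeta0 σ) (.zeta3 j τ) :=
  ⟨some j, by simp [gFactor, bobFactor, inner_ket_superpose_of_ne]⟩

theorem zeta1_zeta1 {i j : Fin m} {σ τ : ℤˣ} (h : i = j → σ ≠ τ) :
    HaveOrthogonalFactor (.zeta1 i σ) (.zeta1 j τ) := by
  rcases eq_or_ne i j with rfl | hij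
  · exact ⟨some i, by simp [gFactor, bobFactor, inner_superpose_superpose_of_ne, h]⟩
  · exact ⟨none, by simp [gFactor, aliceFactor, inner_ket_ket, hij]⟩

theorem zeta1_zeta2 (i : Fin m) (σ : ℤˣ) (j : Fin m) (τ : ℤˣ) :
    HaveOrthogonalFactor (.zeta1 i σ) (.zeta2 j τ) := by
  rcases eq_or_ne i j with rfl | hij
  · exact symm ⟨some i, by simp [gFactor, bobFactor, inner_ket_superpose_of_ne]⟩
  · exact ⟨none, inner_ket_superpose_of_ne (one_ne_succ_succ i).symm (by simpa using hij)⟩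

theorem zeta1_zeta3 (i : Fin m) (σ : ℤˣ) (j : Fin m) (τ : ℤˣ) :
    HaveOrthogonalFactor (.zeta1 i σ) (.zeta3 j τ) :=
  ⟨none, by simp [gFactor, aliceFactor, inner_ket_ket]⟩

theorem zeta2_zeta2 {i j : Fin m} {σ τ : ℤˣ} (h : i = j → σ ≠ τ) :
    HaveOrthogonalFactor (.zeta2 i σ) (.zeta2 j τ) := by
  rcases eq_or_ne i j with rfl | hij
  · exact ⟨none, inner_superpose_superpose_of_ne (one_ne_succ_succ i) (h rfl)⟩
  · exact ⟨some i, by simp [gFactor, bobFactor, inner_ket_ket, hij]⟩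

theorem zeta2_zeta3 (i : Fin m) (σ : ℤˣ) (j : Fin m) (τ : ℤˣ) :
    HaveOrthogonalFactor (.zeta2 i σ) (.zeta3 j τ) :=
  symm ⟨none, inner_ket_superpose_of_ne (by simp) (Fin.succ_ne_zero _).symm⟩

theorem zeta3_zeta3 {i j : Fin m} {σ τ : ℤˣ} (h : i = j → σ ≠ τ) :
    HaveOrthogonalFactor (.zeta3 i σ) (.zeta3 j τ) := by
  rcases eq_or_ne i j with rfl | hij
  · exact ⟨some i, by simp [gFactor, bobFactor, inner_superpose_superpose_of_ne, h]⟩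
  · exact symm ⟨some i, by simp [gFactor, bobFactor, inner_ket_superpose_of_ne, hij]⟩

theorem of_ne {g h : StateLabel m} (hgh : g ≠ h) : HaveOrthogonalFactor g h := by
  rcases g with σ | ⟨i, σ⟩ | ⟨i, σ⟩ | ⟨i, σ⟩ <;> rcases h with τ | ⟨j, τ⟩ | ⟨j, τ⟩ | ⟨j, τ⟩
  · exact zeta0_zeta0 (by simpa using hgh)
  · exact zeta0_zeta1 σ j τ
  · exact zeta0_zeta2 σ j τ
  · exact zeta0_zeta3 σ j τ
  · exact (zeta0_zeta1 τ i σ).symm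
  · exact zeta1_zeta1 (by simpa using hgh)
  · exact zeta1_zeta2 i σ j τ
  · exact zeta1_zeta3 i σ j τ
  · exact (zeta0_zeta2 τ i σ).symm
  · exact (zeta1_zeta2 j τ i σ).symm
  · exact zeta2_zeta2 (by simpa using hgh)
  · exact zeta2_zeta3 i σ j τ
  · exact (zeta0_zeta3 τ i σ).symm
  · exact (zeta1_zeta3 j τ i σ).symm
  · exact (zeta2_zeta3 j τ i σ).symm
  · exact zeta3_zeta3 (by simpa using hgh)

end HaveOrthogonalFactor

theorem orthonormal_gState (m : ℕ) : Orthonormal ℂ (gState m) := by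
  refine ⟨fun g => ?_, fun g h hgh => ?_⟩
  · rw [gState_eq_productState_gFactor]
    exact norm_productState_eq_one (norm_gFactor g)
  · obtain ⟨j, hj⟩ := HaveOrthogonalFactor.of_ne hgh
    exact (inner_productState _ _).trans (Finset.prod_eq_zero (Finset.mem_univ j) hj)

/-- The inclusion into `𝔾_{m+1}` of the domino set `𝔾_2` shared by Alice and the `i`-th Bob. -/
def dominoLabel (i : Fin m) : StateLabel 1 → StateLabel m
  | .zeta0 σ => .zeta0 σ
  | .zeta1 _ σ => .zeta1 i σ
  | .zeta2 _ σ => .zeta2 i σ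
  | .zeta3 _ σ => .zeta3 i σ

theorem dominoLabel_injective (i : Fin m) : Function.Injective (dominoLabel i) := by
  rintro (σ | ⟨a, σ⟩ | ⟨a, σ⟩ | ⟨a, σ⟩) (τ | ⟨b, τ⟩ | ⟨b, τ⟩ | ⟨b, τ⟩) h <;>
    simp_all [dominoLabel, eq_iff_true_of_subsingleton]

theorem gFactor_dominoLabel_eq_of_ne {i : Fin m} {j : Party m} (hj : j ≠ none)
    (hji : j ≠ some i) (d d' : StateLabel 1) :
    gFactor m (dominoLabel i d) j = gFactor m (dominoLabel i d') j := by
  obtain ⟨j, rfl⟩ := Option.ne_none_iff_exists'.1 hj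
  have hji' : j ≠ i := fun h => hji (congrArg some h)
  have eq_ket (d) : bobFactor m j (dominoLabel i d) = ket 2 := by
    cases d <;> simp [dominoLabel, bobFactor, hji']
  exact (eq_ket d).trans (eq_ket d').symm

theorem isScaledIsometryOn_aliceFactor (i : Fin m) {W : Type*} [NormedAddCommGroup W]
    [InnerProductSpace ℂ W] {K : EuclideanSpace ℂ (Fin (m + 2)) →ₗ[ℂ] W}
    (hK : ∀ d d', d ≠ d' →
      inner ℂ (bobFactor m i (dominoLabel i d)) (bobFactor m i (dominoLabel i d')) ≠ 0 →
      inner ℂ (K (aliceFactor m (dominoLabel i d))) (K (aliceFactor m (dominoLabel i d'))) = 0) :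
    IsScaledIsometryOn K (Set.range fun d => aliceFactor m (dominoLabel i d)) := by
  have htriple : IsScaledIsometryOn K {ket 0, ket 1, ket i.succ.succ} := by
    refine isScaledIsometryOn_ket_triple (by simp) (one_ne_succ_succ i) (Fin.succ_ne_zero _).symm
      (hK (.zeta0 1) (.zeta0 (-1)) (by decide) ?_)
      (hK (.zeta2 0 1) (.zeta2 0 (-1)) (by decide) ?_)
      (fun σ => hK (.zeta3 0 1) (.zeta2 0 σ) (by simp) ?_)
      (fun σ => hK (.zeta1 0 1) (.zeta0 σ) (by simp) ?_)
    all_goals simp only [dominoLabel, bobFactor, if_true]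
    · exact inner_self_ne_zero.2 (ket_ne_zero _)
    · exact inner_self_ne_zero.2 (ket_ne_zero _)
    · exact inner_eq_zero_symm.not.1 (inner_ket_left_superpose_ne_zero (by decide))
    · exact inner_eq_zero_symm.not.1 (inner_ket_right_superpose_ne_zero (by decide))
  refine htriple.span.mono ?_
  rintro _ ⟨σ | ⟨_, σ⟩ | ⟨_, σ⟩ | ⟨_, σ⟩, rfl⟩
  · exact superpose_mem_span (by simp) (by simp) σ
  · exact Submodule.subset_span (by simp [dominoLabel, aliceFactor])
  · exact superpose_mem_span (by simp) (by simp) σ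
  · exact Submodule.subset_span (by simp [dominoLabel, aliceFactor])

theorem isScaledIsometryOn_bobFactor (i : Fin m) {W : Type*} [NormedAddCommGroup W]
    [InnerProductSpace ℂ W] {K : EuclideanSpace ℂ (Fin 3) →ₗ[ℂ] W}
    (hK : ∀ d d', d ≠ d' →
      inner ℂ (aliceFactor m (dominoLabel i d)) (aliceFactor m (dominoLabel i d')) ≠ 0 →
      inner ℂ (K (bobFactor m i (dominoLabel i d))) (K (bobFactor m i (dominoLabel i d'))) = 0) :
    IsScaledIsometryOn K (Set.range fun d => bobFactor m i (dominoLabel i d)) := by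
  have htriple : IsScaledIsometryOn K {ket 0, ket 1, ket 2} := by
    have h₁ := hK (.zeta3 0 1) (.zeta3 0 (-1)) (by decide)
      (inner_self_ne_zero.2 (ket_ne_zero _))
    have h₂ := hK (.zeta1 0 1) (.zeta1 0 (-1)) (by decide)
      (inner_self_ne_zero.2 (ket_ne_zero _))
    have h₃ (σ : ℤˣ) := hK (.zeta2 0 1) (.zeta1 0 σ) (by simp)
      (inner_eq_zero_symm.not.1 (inner_ket_right_superpose_ne_zero (one_ne_succ_succ i)))
    have h₄ (σ : ℤˣ) := hK (.zeta0 1) (.zeta3 0 σ) (by simp)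
      (inner_eq_zero_symm.not.1 (inner_ket_left_superpose_ne_zero (by simp)))
    simp only [dominoLabel, bobFactor, if_true] at h₁ h₂ h₃ h₄
    exact isScaledIsometryOn_ket_triple (by decide) (by decide) (by decide) h₁ h₂ h₃ h₄
  refine htriple.span.mono ?_
  rintro _ ⟨σ | ⟨_, σ⟩ | ⟨_, σ⟩ | ⟨_, σ⟩, rfl⟩ <;>
    simp only [dominoLabel, bobFactor, if_true]
  · exact Submodule.subset_span (by simp)
  · exact superpose_mem_span (by simp) (by simp) σ
  · exact Submodule.subset_span (by simp)
  · exact superpose_mem_span (by simp) (by simp) σ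

theorem isLocallyStable_gFactor_dominoLabel (i : Fin m) :
    IsLocallyStable fun d => gFactor m (dominoLabel i d) := by
  have inner_idle_ne_zero {j : Party m} (hj : j ≠ none) (hji : j ≠ some i) (d d') :
      inner ℂ (gFactor m (dominoLabel i d) j) (gFactor m (dominoLabel i d') j) ≠ 0 := by
    rw [gFactor_dominoLabel_eq_of_ne hj hji d d', inner_self_ne_zero, ← norm_ne_zero_iff,
      norm_gFactor]
    exact one_ne_zero
  intro j n K hK
  by_cases hj : j = none
  · subst hj
    refine isScaledIsometryOn_aliceFactor i fun d d' hd hne => (hK d d' hd).resolve_right ?_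
    rintro ⟨j, hj, h⟩
    by_cases hji : j = some i
    · subst hji
      exact hne h
    · exact inner_idle_ne_zero hj hji d d' h
  by_cases hji : j = some i
  · subst hji
    refine isScaledIsometryOn_bobFactor i fun d d' hd hne => (hK d d' hd).resolve_right ?_
    rintro ⟨j, hji, h⟩
    by_cases hj : j = none
    · subst hj
      exact hne h
    · exact inner_idle_ne_zero hj hji d d' h
  refine IsScaledIsometryOn.of_subsingleton ?_
  rintro _ ⟨d, rfl⟩ _ ⟨d', rfl⟩
  exact gFactor_dominoLabel_eq_of_ne hj hji d d'

theorem isLocallyStable_regroup_gFactor_dominoLabel {κ : Type} [DecidableEq κ]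
    {part : Party m → κ} {i : Fin m} (hi : part none ≠ part (some i)) :
    IsLocallyStable fun d c =>
      productState fun j : {j // part j = c} => gFactor m (dominoLabel i d) j := by
  refine (isLocallyStable_gFactor_dominoLabel i).regroup (fun _ => norm_gFactor _) part ?_
  intro j j' hjj' hpart
  by_cases hj : j = none ∨ j = some i
  · refine Or.inr (gFactor_dominoLabel_eq_of_ne ?_ ?_) <;> grind
  · push Not at hj
    exact Or.inl (gFactor_dominoLabel_eq_of_ne hj.1 hj.2)

theorem not_loccDiscriminable_regroup_gState {κ : Type} [Fintype κ] [DecidableEq κ]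
    {part : Party m → κ} {i : Fin m} (hi : part none ≠ part (some i)) :
    ¬ LOCCDiscriminable fun g => regroup part (gState m g) := by
  have : Nontrivial (StateLabel 1) := ⟨.zeta0 1, .zeta0 (-1), by decide⟩
  exact (isLocallyStable_regroup_gFactor_dominoLabel hi).not_loccDiscriminable
    (fun d c => norm_productState_eq_one fun j => norm_gFactor _ _)
    (dominoLabel_injective i) fun d => regroup_productState part _

theorem exists_part_none_ne {κ : Type*} {part : Party m → κ} (h : ∃ a b, part a ≠ part b) :
    ∃ i, part none ≠ part (some i) := by
  obtain ⟨a, b, hab⟩ := h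
  by_contra! hall
  have eq_none : ∀ j, part j = part none := Option.forall.2 ⟨rfl, fun i => (hall i).symm⟩
  exact hab ((eq_none a).trans (eq_none b).symm)

theorem isGNPS_gState (m : ℕ) : IsGNPS (gState m) := by
  refine ⟨fun g => ⟨gFactor m g, norm_gFactor g, rfl⟩, orthonormal_gState m, fun k part h => ?_⟩
  obtain ⟨i, hi⟩ := exists_part_none_ne h
  exact not_loccDiscriminable_regroup_gState hi

end GStates

end

theorem proposition2 (m : ℕ) (hm : 1 ≤ m) :
    IsGNPS (gState m) ∧
    ∀ j : Party m, ¬ LOCCDiscriminable fun g => regroup (allBut j) (gState m g) := by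
  refine ⟨isGNPS_gState m, fun j => (isGNPS_gState m).2.2 2 (allBut j) ?_⟩
  have : Nonempty (Fin m) := ⟨⟨0, hm⟩⟩
  obtain ⟨b, hb⟩ := exists_ne j
  exact ⟨j, b, by simp [allBut, hb]⟩
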